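/- Let $d,n\ge 1$ be integers. Call a set $A\subseteq\mathbb R^d$ a rare set if it is open, increasing ($\mathbf x\in A$ and $\mathbf y\in[0,\infty)^d$ imply $\mathbf x+\mathbf y\in A$), its complement $A^c$ is convex, and $\mathbf 0\notin\overline A$. For a random vector $\mathbf Z$ with values in $[0,\infty)^d$ and distribution $V$, put $Z_A:=\sup\{u:\mathbf Z\in uA\}$ (with $\sup\emptyset:=0$) and let $V_A$ be the distribution of $Z_A$. For a distribution $G$ on $[0,\infty)$ write $\overline G(x)=G((x,\infty))$. A distribution $G$ belongs to the class $\mathcal C$ (consistently varying) if $\overline G(x)>0$ for all $x\in\mathbb R$ and $$\lim_{b\uparrow1}\limsup_{x\to\infty}\frac{\overline G(bx)}{\overline G(x)}=1 ;$$ $V\in\mathcal C_A$ means $V_A\in\mathcal C$. The upper Matuszewska index of $G$ is $$J_G^+:=-\lim_{y\to\infty}\frac{\log\overline G_*(y)}{\log y},\qquad \overline G_*(y):=\liminf_{x\to\infty}\frac{\overline G(yx)}{\overline G(x)} .$$ Nonnegative random vectors $\mathbf Z^{(1)},\dots,\mathbf Z^{(n)}$ are quasi-asymptotically independent on $A$ ($QAI_A$)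 if, for all $i\ne j$, $$\lim_{x\to\infty}\frac{\mathbf P[Z_A^{(i)}>x,\;Z_A^{(j)}>x]}{\mathbf P[Z_A^{(i)}>x]+\mathbf P[Z_A^{(j)}>x]}=0 .$$ Lemma. Let $A$ be a rare set and let $\mathbf Z^{(1)},\dots,\mathbf Z^{(n)}$ be random vectors with values in $[0,\infty)^d$ that are $QAI_A$ and have distributions $V_1,\dots,V_n\in\mathcal C_A$, respectively. Let $W_1,\dots,W_n$ be nonnegative random variables, arbitrarily dependent on each other, none of them almost surely equal to $0$, such that $(W_1,\dots,W_n)$ is independent of $(\mathbf Z^{(1)},\dots,\mathbf Z^{(n)})$. Write $V_A^{(i)}$ for the distribution of $Z_A^{(i)}$. If there is some $p>\max_{1\le i\le n}J^+_{V_A^{(i)}}$ with $\mathbf E[W_i^p]<\infty$ for every $i=1,\dots,n$, then $$\lim_{x\to\infty}\frac{\mathbf P\Big[\sum_{i=1}^n W_i\,\mathbf Z^{(i)}\in xA\Big]}{\sum_{i=1}^n\mathbf P\big[W_i\,\mathbf Z^{(i)}\in xA\big]}=1 .$$ -/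

import Mathlib

open Filter Topology MeasureTheory ProbabilityTheory Set
open scoped ENNReal Pointwise

namespace BigJump

/-- The family of "rare sets" of `ℝ^d`: open, increasing sets with convex complement whose closure
does not contain the origin. -/
structure IsRareSet {d : ℕ} (A : Set (Fin d → ℝ)) : Prop where
  isOpen : IsOpen A
  increasing : ∀ x ∈ A, ∀ y : Fin d → ℝ, 0 ≤ y → x + y ∈ A
  convex_compl : Convex ℝ Aᶜ
  zero_notMem_closure : (0 : Fin d → ℝ) ∉ closure A

/-- The map `z ↦ z_A = sup {u : z ∈ u A}`. For a rare set `A` the set of such `u` is bounded above;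
if it is empty the value is `0`. -/
noncomputable def rareSup {d : ℕ} (A : Set (Fin d → ℝ)) (z : Fin d → ℝ) : ℝ :=
  sSup {u : ℝ | z ∈ u • A}

/-- For a rare set the supremum defining `z_A` is over a set that is bounded above. -/
theorem IsRareSet.bddAbove {d : ℕ} {A : Set (Fin d → ℝ)} (hA : IsRareSet A) (z : Fin d → ℝ) :
    BddAbove {u : ℝ | z ∈ u • A} := by
  have h0 := hA.zero_notMem_closure
  rw [Metric.mem_closure_iff] at h0
  push Not at h0
  obtain ⟨ε, hε, h⟩ := h0
  refine ⟨‖z‖ / ε, ?_⟩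
  rintro u ⟨a, ha, rfl⟩
  rw [le_div_iff₀ hε]
  have h1 : ε ≤ ‖a‖ := by simpa using h a ha
  calc u * ε ≤ |u| * ‖a‖ := by
        have := le_abs_self u
        have := abs_nonneg u
        gcongr
    _ = ‖u • a‖ := by rw [norm_smul, Real.norm_eq_abs]

/-- For a rare set the map `z ↦ z_A` is Borel, so that `Z_A` is a random variable. -/
theorem IsRareSet.measurable_rareSup {d : ℕ} {A : Set (Fin d → ℝ)} (hA : IsRareSet A) :
    Measurable (rareSup A) := by
  have h0 : MeasurableSet ((0 : ℝ) • A) := by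
    rcases A.eq_empty_or_nonempty with h | h
    · simp [h]
    · rw [zero_smul_set h]; exact measurableSet_singleton 0
  have key : ∀ p : ℝ → Prop, MeasurableSet {z : Fin d → ℝ | ∃ u : ℝ, p u ∧ z ∈ u • A} := by
    intro p
    have e : {z : Fin d → ℝ | ∃ u : ℝ, p u ∧ z ∈ u • A} =
        (⋃ u ∈ {u : ℝ | p u ∧ u ≠ 0}, u • A) ∪ {z | p 0 ∧ z ∈ (0 : ℝ) • A} := by
      ext z
      simp only [mem_ofPred_eq, mem_union, mem_iUnion, exists_prop]
      constructor
      · rintro ⟨u, hu, hz⟩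
        by_cases h : u = 0
        · subst h; exact Or.inr ⟨hu, hz⟩
        · exact Or.inl ⟨u, ⟨hu, h⟩, hz⟩
      · rintro (⟨u, ⟨hu, -⟩, hz⟩ | ⟨hu, hz⟩)
        · exact ⟨u, hu, hz⟩
        · exact ⟨0, hu, hz⟩
    rw [e]
    refine MeasurableSet.union ?_ ((MeasurableSet.const (p 0)).inter h0)
    exact (isOpen_biUnion fun u hu => hA.isOpen.smul₀ hu.2).measurableSet
  refine measurable_of_Ioi fun x => ?_
  have e : rareSup A ⁻¹' Ioi x =
      {z : Fin d → ℝ | ∃ u : ℝ, x < u ∧ z ∈ u • A} ∪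
        ({z : Fin d → ℝ | ∃ u : ℝ, True ∧ z ∈ u • A}ᶜ ∩ {_z : Fin d → ℝ | x < 0}) := by
    ext z
    simp only [mem_preimage, mem_Ioi, mem_union, mem_ofPred_eq, mem_inter_iff, mem_compl_iff,
      true_and, rareSup]
    by_cases hne : {u : ℝ | z ∈ u • A}.Nonempty
    · rw [lt_csSup_iff (hA.bddAbove z) hne]
      have h2 : ∃ u : ℝ, z ∈ u • A := hne
      simp only [h2, not_true_eq_false, false_and, or_false, mem_ofPred_eq]
      exact ⟨fun ⟨u, a, b⟩ => ⟨u, b, a⟩, fun ⟨u, a, b⟩ => ⟨u, b, a⟩⟩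
    · have h2 : ¬ ∃ u : ℝ, z ∈ u • A := hne
      have h3 : ¬ ∃ u : ℝ, x < u ∧ z ∈ u • A := fun ⟨u, _, h⟩ => h2 ⟨u, h⟩
      rw [not_nonempty_iff_eq_empty] at hne
      simp [hne, h2, h3]
  rw [e]
  exact (key _).union ((key _).compl.inter (MeasurableSet.const _))

/-- The law `V_A` of `Z_A`, where `V` is the law of the random vector `Z`. -/
noncomputable def rareLaw {d : ℕ} (A : Set (Fin d → ℝ)) (V : Measure (Fin d → ℝ)) : Measure ℝ :=
  V.map (rareSup A)

/-- The class `𝒞` of consistently varying distributions on the line: the tail `G(x, ∞)` never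
vanishes and `lim_{b ↑ 1} limsup_{x → ∞} G(b x, ∞) / G(x, ∞) = 1`. -/
def ConsistentlyVarying (G : Measure ℝ) : Prop :=
  (∀ x : ℝ, 0 < G (Ioi x)) ∧
    Tendsto (fun b : ℝ => limsup (fun x : ℝ => G (Ioi (b * x)) / G (Ioi x)) atTop)
      (𝓝[<] 1) (𝓝 1)

/-- The class `𝒞_A`: the laws `V` of random vectors for which `V_A` is consistently varying. -/
def ConsistentlyVaryingOn {d : ℕ} (A : Set (Fin d → ℝ)) (V : Measure (Fin d → ℝ)) : Prop :=
  ConsistentlyVarying (rareLaw A V)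

/-- `G_*(y) = liminf_{x → ∞} G(y x, ∞) / G(x, ∞)`. -/
noncomputable def lowerTailRatio (G : Measure ℝ) (y : ℝ) : ℝ≥0∞ :=
  liminf (fun x : ℝ => G (Ioi (y * x)) / G (Ioi x)) atTop

/-- The upper Matuszewska index `J_G^+ = - lim_{y → ∞} log G_*(y) / log y`, with values in
`[-∞, ∞]` and `log 0 = -∞`. For a distribution with non-vanishing tail, `G_*` is nonincreasing and
supermultiplicative on `(1, ∞)`, so the limit exists and equals the lower limit written here. -/
noncomputable def upperMatuszewskaIndex (G : Measure ℝ) : EReal :=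
  liminf (fun y : ℝ => -(ENNReal.log (lowerTailRatio G y)) / (Real.log y : EReal)) atTop

/-- Quasi-asymptotic independence of a family of nonnegative random variables. -/
def QAI {Ω ι : Type*} [MeasurableSpace Ω] (μ : Measure Ω) (X : ι → Ω → ℝ) : Prop :=
  ∀ i j, i ≠ j →
    Tendsto (fun x : ℝ => μ.real {ω | x < X i ω ∧ x < X j ω} /
        (μ.real {ω | x < X i ω} + μ.real {ω | x < X j ω})) atTop (𝓝 0)

/-- Quasi-asymptotic independence on `A` of a family of nonnegative random vectors. -/
def QAIOn {Ω ι : Type*} [MeasurableSpace Ω] (μ : Measure Ω) {d : ℕ} (A : Set (Fin d → ℝ))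
    (Z : ι → Ω → Fin d → ℝ) : Prop :=
  QAI μ fun i ω => rareSup A (Z i ω)

end BigJump

namespace BigJump

/-! ### The gauge `z_A` of a rare set. -/

section RareSet

variable {d : ℕ} {A : Set (Fin d → ℝ)}

/-! On nonnegative vectors `z_A` is the Minkowski gauge of the convex set `Aᶜ`: it is subadditive
and positively homogeneous, and `z ∈ x • A` means `x < z_A` for `x > 0`. With `X i` the gauge of `Z
i`, the event that the weighted sum lies in `x • A` is contained in `{x < ∑ W i * X i}` by
subadditivity. It contains each `{x < W i * X i}` because `A` is increasing. So it suffices to bound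
the probability of the first event above, and that of the union of the others below, by `(1 ± ε) ∑
P(W i * X i > x)` (`eventually_weighted_sum_bounds`).

Above: a sum exceeding `x` has a term above `b * x`, or two terms above `(1 - b) / n * x`.
Consistent variation makes the passage from `b * x` to `x` cheap as `b ↑ 1`, and joint exceedances
are negligible. Below: Bonferroni, with the same negligibility.

The weights enter by conditioning on one of them. An estimate for `X` at large levels applies at
level `x / W` as long as `W` is at most a small multiple of `x`. Larger weights have probability
`O(x ^ (-p))` by Markov, which is `o(P(X > x))` because `p` exceeds the Matuszewska index (Potter
bounds, recorded in `TailControl`). Errors relative to `P(X > x)` are converted to `P(W * X > x)` by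
`exists_tail_le_weighted`. In joint exceedances with two weights, the larger weight can replace the
smaller, so dependence between weights plays no role. -/

theorem IsRareSet.zero_notMem (hA : IsRareSet A) : (0 : Fin d → ℝ) ∉ A :=
  fun h => hA.zero_notMem_closure (subset_closure h)

theorem mem_smul_iff_inv {x : ℝ} (hx : x ≠ 0) (z : Fin d → ℝ) : z ∈ x • A ↔ x⁻¹ • z ∈ A :=
  mem_smul_set_iff_inv_smul_mem₀ hx A z

/-- `Aᶜ` is convex and contains `0`, so it is star-shaped about `0`; `a` lies on the segment from
`0` to `c • a`. -/
theorem IsRareSet.smul_mem (hA : IsRareSet A) {a : Fin d → ℝ} (ha : a ∈ A) {c : ℝ} (hc : 1 ≤ c) :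
    c • a ∈ A := by
  by_contra h
  have hc0 : 0 < c := by linarith
  have h1 : c⁻¹ ≤ 1 := inv_le_one_of_one_le₀ hc
  have := hA.convex_compl h hA.zero_notMem (a := c⁻¹) (b := 1 - c⁻¹) (by positivity)
    (by linarith) (by ring)
  rw [smul_smul, inv_mul_cancel₀ hc0.ne', one_smul, smul_zero, add_zero] at this
  exact this ha

/-- For positive dilations, membership in `x • A` is the event `x < z_A`. -/
theorem IsRareSet.mem_smul_iff (hA : IsRareSet A) {x : ℝ} (hx : 0 < x) (z : Fin d → ℝ) :
    z ∈ x • A ↔ x < rareSup A z := by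
  constructor
  · intro h
    have hc : ContinuousAt (fun u : ℝ => u⁻¹ • z) x :=
      (continuousAt_inv₀ hx.ne').smul continuousAt_const
    have h1 : ∀ᶠ u in 𝓝 x, u⁻¹ • z ∈ A :=
      hc (hA.isOpen.mem_nhds ((mem_smul_iff_inv hx.ne' z).1 h))
    -- Openness of `A` leaves room for some `u > x`, which makes the inequality strict.
    have h2 : ∀ᶠ u in 𝓝[>] x, u⁻¹ • z ∈ A := h1.filter_mono nhdsWithin_le_nhds
    obtain ⟨u, hu, hxu⟩ := (h2.and self_mem_nhdsWithin).exists
    have hxu : x < u := hxu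
    exact hxu.trans_le
      (le_csSup (hA.bddAbove z) ((mem_smul_iff_inv (hx.trans hxu).ne' z).2 hu))
  · intro h
    have hne : {u : ℝ | z ∈ u • A}.Nonempty := by
      by_contra hne
      rw [not_nonempty_iff_eq_empty] at hne
      rw [rareSup, hne, Real.sSup_empty] at h
      linarith
    obtain ⟨u, hu, hxu⟩ := exists_lt_of_lt_csSup hne h
    have hu0 : 0 < u := hx.trans hxu
    rw [mem_smul_iff_inv hx.ne']
    have := hA.smul_mem ((mem_smul_iff_inv hu0.ne' z).1 hu) (c := u / x)
      ((one_le_div hx).2 hxu.le)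
    rwa [smul_smul, show u / x * u⁻¹ = x⁻¹ by field_simp] at this

theorem IsRareSet.smul_mem_smul_iff (hA : IsRareSet A) {x w : ℝ} (hx : 0 < x) (hw : 0 ≤ w)
    (z : Fin d → ℝ) : w • z ∈ x • A ↔ x < w * rareSup A z := by
  rcases hw.eq_or_lt with rfl | hw
  · rw [zero_smul, mem_smul_iff_inv hx.ne', smul_zero, zero_mul]
    exact iff_of_false hA.zero_notMem (by linarith)
  · rw [← div_lt_iff₀' hw, ← hA.mem_smul_iff (by positivity), mem_smul_iff_inv hx.ne',
      mem_smul_iff_inv (by positivity), smul_smul, inv_div, inv_mul_eq_div]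

/-- No negative `u` is admissible: adding `-u⁻¹ • z ≥ 0` to `u⁻¹ • z ∈ A` would put `0` in `A`. -/
theorem IsRareSet.rareSup_nonneg (hA : IsRareSet A) {z : Fin d → ℝ} (hz : 0 ≤ z) :
    0 ≤ rareSup A z := by
  refine Real.sSup_nonneg fun u hu => ?_
  by_contra h
  push Not at h
  have h1 := hA.increasing _ ((mem_smul_iff_inv h.ne z).1 hu) ((-u⁻¹) • z)
    (smul_nonneg (by simpa using h.le) hz)
  rw [← add_smul, add_neg_cancel, zero_smul] at h1
  exact hA.zero_notMem h1

/-- For `s`, `t` slightly above the two gauges, `(s + t)⁻¹ • (z + z')` is a convex combination of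
`s⁻¹ • z` and `t⁻¹ • z'`, both in `Aᶜ`. The `ε / 2` keeps `s` and `t` positive when a gauge
vanishes. -/
theorem IsRareSet.rareSup_add_le (hA : IsRareSet A) {z z' : Fin d → ℝ} (hz : 0 ≤ rareSup A z)
    (hz' : 0 ≤ rareSup A z') : rareSup A (z + z') ≤ rareSup A z + rareSup A z' := by
  refine le_of_forall_pos_le_add fun ε hε => ?_
  have hs : 0 < rareSup A z + ε / 2 := by positivity
  have ht : 0 < rareSup A z' + ε / 2 := by positivity
  set s := rareSup A z + ε / 2
  set t := rareSup A z' + ε / 2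
  have h1 : s⁻¹ • z ∉ A := fun h => by
    have := (hA.mem_smul_iff hs z).1 ((mem_smul_iff_inv hs.ne' z).2 h)
    simp only [s] at this
    linarith
  have h2 : t⁻¹ • z' ∉ A := fun h => by
    have := (hA.mem_smul_iff ht z').1 ((mem_smul_iff_inv ht.ne' z').2 h)
    simp only [t] at this
    linarith
  have hst : 0 < s + t := by positivity
  have h3 := hA.convex_compl h1 h2 (a := s / (s + t)) (b := t / (s + t)) (by positivity)
    (by positivity) (by field_simp)
  rw [smul_smul, smul_smul, show s / (s + t) * s⁻¹ = (s + t)⁻¹ by field_simp,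
    show t / (s + t) * t⁻¹ = (s + t)⁻¹ by field_simp, ← smul_add] at h3
  have h4 : ¬ s + t < rareSup A (z + z') := fun h =>
    h3 ((mem_smul_iff_inv hst.ne' _).1 ((hA.mem_smul_iff hst _).2 h))
  simp only [s, t] at h4
  linarith

theorem IsRareSet.rareSup_zero (hA : IsRareSet A) : rareSup A 0 = 0 := by
  refine le_antisymm ?_ (hA.rareSup_nonneg le_rfl)
  by_contra h
  push Not at h
  have h1 := (hA.mem_smul_iff (half_pos h) 0).2 (half_lt_self h)
  rw [mem_smul_iff_inv (half_pos h).ne', smul_zero] at h1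
  exact hA.zero_notMem h1

theorem IsRareSet.rareSup_smul (hA : IsRareSet A) {w : ℝ} (hw : 0 ≤ w) {z : Fin d → ℝ}
    (hz : 0 ≤ z) : rareSup A (w • z) = w * rareSup A z := by
  have h1 := hA.rareSup_nonneg (smul_nonneg hw hz)
  have h2 := mul_nonneg hw (hA.rareSup_nonneg hz)
  have key : ∀ x : ℝ, 0 < x → (x < rareSup A (w • z) ↔ x < w * rareSup A z) := fun x hx => by
    rw [← hA.mem_smul_iff hx, hA.smul_mem_smul_iff hx hw]
  -- Two distinct nonnegative numbers would be separated by their midpoint, which is positive,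
  -- against `key`.
  rcases lt_trichotomy (rareSup A (w • z)) (w * rareSup A z) with h | h | h
  · exact absurd ((key _ (by linarith)).2 (add_div_two_lt_right.2 h)) (by linarith)
  · exact h
  · exact absurd ((key _ (by linarith)).1 (add_div_two_lt_right.2 h)) (by linarith)

theorem IsRareSet.lt_sum_of_mem (hA : IsRareSet A) {ι : Type*} (s : Finset ι) {x : ℝ} (hx : 0 < x)
    {w : ι → ℝ} (hw : ∀ i, 0 ≤ w i) {z : ι → Fin d → ℝ} (hz : ∀ i, 0 ≤ z i)
    (h : ∑ i ∈ s, w i • z i ∈ x • A) : x < ∑ i ∈ s, w i * rareSup A (z i) := by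
  refine ((hA.mem_smul_iff hx _).1 h).trans_le ?_
  have := Finset.le_sum_of_subadditive_on_pred (rareSup A) (fun z => 0 ≤ z) hA.rareSup_zero.le
    (fun a b ha hb => hA.rareSup_add_le (hA.rareSup_nonneg ha) (hA.rareSup_nonneg hb))
    (fun a b ha hb => add_nonneg ha hb) (fun i => w i • z i)
    (fun i (_ : i ∈ s) => smul_nonneg (hw i) (hz i))
  exact this.trans_eq (Finset.sum_congr rfl fun i _ => hA.rareSup_smul (hw i) (hz i))

theorem IsRareSet.sum_mem_of_mem (hA : IsRareSet A) {ι : Type*} [Fintype ι] {x : ℝ} (hx : 0 < x)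
    {v : ι → Fin d → ℝ} (hv : ∀ i, 0 ≤ v i) (i : ι) (h : v i ∈ x • A) : ∑ j, v j ∈ x • A := by
  classical
  rw [mem_smul_iff_inv hx.ne'] at h ⊢
  rw [← Finset.add_sum_erase _ _ (Finset.mem_univ i), smul_add]
  exact hA.increasing _ h _ (smul_nonneg (by positivity) (Finset.sum_nonneg fun j _ => hv j))

end RareSet

/-! ### Potter bounds and consistent variation. -/

section Tail

/-- A finite upper Matuszewska index gives a one-step comparison of tails. -/
theorem exists_tail_step {G : Measure ℝ} [IsProbabilityMeasure G] (hG : ∀ x, 0 < G (Ioi x)) {p : ℝ}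
    (hp : upperMatuszewskaIndex G < p) :
    ∃ q, 0 < q ∧ q < p ∧ ∃ y : ℝ, 1 < y ∧
      ∀ᶠ x in atTop, G.real (Ioi x) ≤ y ^ q * G.real (Ioi (y * x)) := by
  obtain ⟨q, hq1, hq2⟩ := EReal.lt_iff_exists_real_btwn.1 hp
  -- A lower limit only supplies arbitrarily large `y`, but a single `y > 1` suffices, since the
  -- step is iterated later.
  have hfr := frequently_lt_of_liminf_lt (by isBoundedDefault) hq1
  obtain ⟨y, hy, hy1⟩ := (hfr.and_eventually (eventually_gt_atTop (1 : ℝ))).exists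
  have hlog : 0 < Real.log y := Real.log_pos hy1
  have hy0 : 0 < y := by linarith
  have h1 : ENNReal.ofReal (y ^ (-q)) < lowerTailRatio G y := by
    rw [EReal.div_lt_iff (by exact_mod_cast hlog) (by simp)] at hy
    have h2 : ((-(q * Real.log y) : ℝ) : EReal) < ENNReal.log (lowerTailRatio G y) := by
      rw [EReal.coe_neg, EReal.coe_mul]
      exact EReal.neg_lt_comm.1 hy
    rw [← ENNReal.log_lt_log_iff, ENNReal.log_ofReal_of_pos (by positivity),
      Real.log_rpow hy0, neg_mul]
    exact h2
  have h3 := eventually_lt_of_lt_liminf h1 (by isBoundedDefault)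
  have h4 : ∀ᶠ x : ℝ in atTop, y ^ (-q) * G.real (Ioi x) < G.real (Ioi (y * x)) := by
    filter_upwards [h3] with x hx
    rw [ENNReal.lt_div_iff_mul_lt (Or.inl (hG x).ne') (Or.inl (measure_ne_top _ _))] at hx
    have := (ENNReal.toReal_lt_toReal (by finiteness) (by finiteness)).2 hx
    rwa [ENNReal.toReal_mul, ENNReal.toReal_ofReal (by positivity)] at this
  -- `y ^ (-q) * G(x, ∞) < G(y * x, ∞) ≤ G(x, ∞)` forces `y ^ (-q) < 1`.
  have hq0 : 0 < q := by
    obtain ⟨x, hx, hx0⟩ := (h4.and (eventually_gt_atTop (0 : ℝ))).exists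
    have hm : G.real (Ioi (y * x)) ≤ G.real (Ioi x) :=
      measureReal_mono (Ioi_subset_Ioi (by nlinarith))
    have hpos : 0 < G.real (Ioi x) := ENNReal.toReal_pos (hG x).ne' (measure_ne_top _ _)
    have : y ^ (-q) < 1 := by nlinarith
    by_contra hq
    push Not at hq
    have := Real.one_le_rpow hy1.le (z := -q) (by linarith)
    linarith
  refine ⟨q, hq0, by exact_mod_cast hq2, y, hy1, ?_⟩
  filter_upwards [h4] with x hx
  rw [Real.rpow_neg hy0.le, inv_mul_lt_iff₀ (by positivity)] at hx
  exact hx.le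

/-- A Potter-type bound. -/
theorem exists_potter_bound {H : ℝ → ℝ} (hH : Antitone H) (hpos : ∀ x, 0 < H x) {q y : ℝ}
    (hq : 0 < q) (hy : 1 < y) (hstep : ∀ᶠ x in atTop, H x ≤ y ^ q * H (y * x)) :
    ∃ C x₀ : ℝ, 0 < C ∧ 0 < x₀ ∧ ∀ x, x₀ ≤ x → ∀ u, 1 ≤ u → H x ≤ C * u ^ q * H (u * x) := by
  obtain ⟨x₁, hx₁⟩ := eventually_atTop.1 hstep
  have hy0 : 0 < y := by linarith
  -- The constant `y ^ q` pays for rounding `u` up to a power `y ^ (k + 1) ≤ y * u`.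
  refine ⟨y ^ q, max x₁ 1, by positivity, by positivity, fun x hx u hu => ?_⟩
  have hx1 : x₁ ≤ x := (le_max_left _ _).trans hx
  have hx0 : 0 < x := lt_of_lt_of_le one_pos ((le_max_right _ _).trans hx)
  have hiter : ∀ k : ℕ, H x ≤ (y ^ k) ^ q * H (y ^ k * x) := by
    intro k
    induction k with
    | zero => simp
    | succ k ih =>
      have hk : 1 ≤ y ^ k := one_le_pow₀ hy.le
      have h1 := hx₁ (y ^ k * x) (hx1.trans (by nlinarith))
      calc H x ≤ (y ^ k) ^ q * H (y ^ k * x) := ih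
        _ ≤ (y ^ k) ^ q * (y ^ q * H (y * (y ^ k * x))) := by gcongr
        _ = (y ^ (k + 1)) ^ q * H (y ^ (k + 1) * x) := by
          rw [pow_succ, Real.mul_rpow (by positivity) hy0.le]
          ring_nf
  obtain ⟨k, hk1, hk2⟩ := exists_nat_pow_near hu hy
  calc H x ≤ (y ^ (k + 1)) ^ q * H (y ^ (k + 1) * x) := hiter _
    _ ≤ (y ^ q * u ^ q) * H (u * x) := by
      have e : (y ^ (k + 1)) ^ q ≤ y ^ q * u ^ q := by
        rw [pow_succ', Real.mul_rpow hy0.le (by positivity)]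
        gcongr
      exact mul_le_mul e (hH (by gcongr)) (hpos _).le (by positivity)

/-- The tail dominates `x ^ (-p)`. -/
theorem eventually_rpow_neg_le {H : ℝ → ℝ} (hpos : ∀ x, 0 < H x) {C x₀ p q : ℝ}
    (hC : 0 < C) (hx₀ : 0 < x₀) (hqp : q < p)
    (hpot : ∀ x, x₀ ≤ x → ∀ u, 1 ≤ u → H x ≤ C * u ^ q * H (u * x)) {ε : ℝ} (hε : 0 < ε) :
    ∀ᶠ x in atTop, x ^ (-p) ≤ ε * H x := by
  have hlim : Tendsto (fun x : ℝ => C * x₀ ^ (-q) * x ^ (-(p - q))) atTop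
      (𝓝 (C * x₀ ^ (-q) * 0)) :=
    (tendsto_rpow_neg_atTop (by linarith)).const_mul _
  rw [mul_zero] at hlim
  have h0 : 0 < ε * H x₀ := mul_pos hε (hpos _)
  filter_upwards [hlim.eventually (gt_mem_nhds h0), eventually_ge_atTop x₀] with x hx hxx
  have hx0 : 0 < x := by linarith
  -- Potter's bound started at the fixed point `x₀` makes `H x` at least a multiple of `x ^ (-q)`,
  -- and `q < p`.
  have h1 := hpot x₀ le_rfl (x / x₀) ((one_le_div hx₀).2 hxx)
  rw [div_mul_cancel₀ _ hx₀.ne', Real.div_rpow hx0.le hx₀.le] at h1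
  have h2 : C * x₀ ^ (-q) * x ^ (-(p - q)) = C * (x ^ q / x₀ ^ q) * x ^ (-p) := by
    rw [Real.rpow_neg hx₀.le, show -(p - q) = q + -p by ring, Real.rpow_add hx0]
    ring
  rw [h2] at hx
  have h3 : 0 < C * (x ^ q / x₀ ^ q) := by positivity
  have h4 : C * (x ^ q / x₀ ^ q) * x ^ (-p) ≤ C * (x ^ q / x₀ ^ q) * (ε * H x) := by
    nlinarith [mul_le_mul_of_nonneg_left h1 hε.le]
  exact le_of_mul_le_mul_left h4 h3

/-- The threshold in `x` does not depend on `w`, so the bound can be integrated over a random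
weight. The three summands of `K` serve three cases: monotonicity for `w ≤ 1`, Potter for `x / w ≥
x₀`, and otherwise `H ≤ 1 ≤ (x₀ * w / x) ^ p` together with `x ^ (-p) ≤ H x`. -/
theorem exists_uniform_bound {H : ℝ → ℝ} (hH : Antitone H) (hpos : ∀ x, 0 < H x)
    (hle : ∀ x, H x ≤ 1) {C x₀ p q : ℝ}
    (hC : 0 < C) (hx₀ : 0 < x₀) (hq : 0 < q) (hqp : q < p)
    (hpot : ∀ x, x₀ ≤ x → ∀ u, 1 ≤ u → H x ≤ C * u ^ q * H (u * x)) :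
    ∃ K : ℝ, 0 < K ∧ ∀ᶠ x in atTop, ∀ w, 0 < w → H (x / w) ≤ K * (1 + w ^ p) * H x := by
  refine ⟨1 + C + x₀ ^ p, by positivity, ?_⟩
  filter_upwards [eventually_rpow_neg_le hpos hC hx₀ hqp hpot one_pos, eventually_ge_atTop x₀]
    with x hx hxx w hw
  have hx0 : 0 < x := by linarith
  have hwp : 0 < w ^ p := by positivity
  have hxp : 0 < x₀ ^ p := by positivity
  have hHx := hpos x
  rcases le_total w 1 with hw1 | hw1
  · have h1 : H (x / w) ≤ H x := hH ((le_div_iff₀ hw).2 (by nlinarith))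
    have h2 : 1 ≤ (1 + C + x₀ ^ p) * (1 + w ^ p) := by nlinarith [mul_pos hC hwp, mul_pos hxp hwp]
    nlinarith
  · rcases le_total x₀ (x / w) with h | h
    · have h1 := hpot _ h w hw1
      rw [mul_div_cancel₀ _ hw.ne'] at h1
      have h2 : w ^ q ≤ w ^ p := Real.rpow_le_rpow_of_exponent_le hw1 hqp.le
      refine h1.trans (mul_le_mul_of_nonneg_right ?_ hHx.le)
      nlinarith [mul_pos hC hwp, mul_pos hxp hwp]
    · have h1 : 1 ≤ x₀ ^ p * w ^ p * x ^ (-p) := by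
        rw [Real.rpow_neg hx0.le, ← div_eq_mul_inv, one_le_div (by positivity),
          ← Real.mul_rpow hx₀.le hw.le]
        exact Real.rpow_le_rpow hx0.le ((div_le_iff₀ hw).1 h) (by linarith)
      calc H (x / w) ≤ 1 := hle _
        _ ≤ x₀ ^ p * w ^ p * x ^ (-p) := h1
        _ ≤ x₀ ^ p * w ^ p * (1 * H x) := by gcongr
        _ ≤ _ := by
          rw [one_mul]
          refine mul_le_mul_of_nonneg_right ?_ hHx.le
          nlinarith [mul_pos hC hwp, mul_pos hxp hwp]

theorem ConsistentlyVarying.exists_tail_le {G : Measure ℝ} [IsProbabilityMeasure G]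
    (hG : ConsistentlyVarying G) {ε : ℝ} (hε : 0 < ε) :
    ∀ᶠ b in 𝓝[<] (1 : ℝ),
      ∀ᶠ x in atTop, G.real (Ioi (b * x)) ≤ (1 + ε) * G.real (Ioi x) := by
  have h1 : (1 : ℝ≥0∞) < ENNReal.ofReal (1 + ε) := by
    rw [ENNReal.one_lt_ofReal]; linarith
  filter_upwards [hG.2.eventually (gt_mem_nhds h1)] with b hb
  filter_upwards [eventually_lt_of_limsup_lt hb (by isBoundedDefault)] with x hx
  rw [ENNReal.div_lt_iff (Or.inl (hG.1 x).ne') (Or.inl (measure_ne_top _ _))] at hx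
  have := ENNReal.toReal_mono (by finiteness) hx.le
  rwa [ENNReal.toReal_mul, ENNReal.toReal_ofReal (by positivity)] at this

end Tail

/-- Polynomial control of order `p` on a tail function `H`. -/
structure TailControl (p : ℝ) (H : ℝ → ℝ) : Prop where
  div_le : ∃ K : ℝ, 0 < K ∧ ∀ᶠ x in atTop, ∀ w, 0 < w → H (x / w) ≤ K * (1 + w ^ p) * H x
  rpow_neg_le : ∀ ε : ℝ, 0 < ε → ∀ᶠ x in atTop, x ^ (-p) ≤ ε * H x

theorem exists_tailControl {G : Measure ℝ} [IsProbabilityMeasure G] (hG : ∀ x, 0 < G (Ioi x))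
    {p : ℝ} (hp : upperMatuszewskaIndex G < p) : 0 < p ∧ TailControl p fun x => G.real (Ioi x) := by
  obtain ⟨q, hq, hqp, y, hy, hstep⟩ := exists_tail_step hG hp
  have hanti : Antitone fun x => G.real (Ioi x) := fun a b hab =>
    measureReal_mono (Ioi_subset_Ioi hab)
  have hpos : ∀ x, 0 < G.real (Ioi x) := fun x => ENNReal.toReal_pos (hG x).ne' (measure_ne_top _ _)
  obtain ⟨C, x₀, hC, hx₀, hpot⟩ := exists_potter_bound hanti hpos hq hy hstep
  exact ⟨hq.trans hqp, exists_uniform_bound hanti hpos (fun x => measureReal_le_one) hC hx₀ hq hqp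
    hpot, fun ε hε => eventually_rpow_neg_le hpos hC hx₀ hqp hpot hε⟩

variable {Ω : Type*} [MeasurableSpace Ω] {μ : Measure Ω} [IsProbabilityMeasure μ]

/-! ### Conditioning on an independent variable. -/

section Conditioning

variable {α β : Type*} [MeasurableSpace α] [MeasurableSpace β] {U : Ω → α} {V : Ω → β}

theorem integrable_section (hU : Measurable U) (hV : Measurable V) {S : Set (α × β)}
    (hS : MeasurableSet S) : Integrable (fun ω => μ.real {ω' | (U ω, V ω') ∈ S}) μ := by
  have := Measure.isProbabilityMeasure_map (μ := μ) hV.aemeasurable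
  have e : (fun ω => μ.real {ω' | (U ω, V ω') ∈ S}) =
      fun ω => (μ.map V (Prod.mk (U ω) ⁻¹' S)).toReal := by
    ext ω
    rw [Measure.map_apply hV (measurable_prodMk_left hS)]
    rfl
  refine Integrable.of_bound (C := 1) ?_ (ae_of_all _ fun ω => ?_)
  · rw [e]
    exact ((measurable_measure_prodMk_left hS).comp hU).ennreal_toReal.aestronglyMeasurable
  · rw [Real.norm_of_nonneg measureReal_nonneg]
    exact measureReal_le_one

/-- Conditioning on one of two independent variables. -/
theorem measureReal_pair_eq_integral (hU : Measurable U) (hV : Measurable V)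
    (hUV : IndepFun U V μ) {S : Set (α × β)} (hS : MeasurableSet S) :
    μ.real {ω | (U ω, V ω) ∈ S} = ∫ ω, μ.real {ω' | (U ω, V ω') ∈ S} ∂μ := by
  have := Measure.isProbabilityMeasure_map (μ := μ) hV.aemeasurable
  have := Measure.isProbabilityMeasure_map (μ := μ) hU.aemeasurable
  have h1 : μ {ω | (U ω, V ω) ∈ S} = ∫⁻ ω, μ {ω' | (U ω, V ω') ∈ S} ∂μ := by
    have e := (indepFun_iff_map_prod_eq_prod_map_map hU.aemeasurable hV.aemeasurable).1 hUV
    have h2 : μ {ω | (U ω, V ω) ∈ S} = μ.map (fun ω => (U ω, V ω)) S :=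
      (Measure.map_apply (hU.prodMk hV) hS).symm
    rw [h2, e, Measure.prod_apply hS, lintegral_map (measurable_measure_prodMk_left hS) hU]
    refine lintegral_congr fun ω => ?_
    rw [Measure.map_apply hV (measurable_prodMk_left hS)]
    rfl
  rw [measureReal_def, h1, ← integral_toReal _ (ae_of_all _ fun ω => measure_lt_top _ _)]
  · rfl
  · have := (integrable_section (μ := μ) hU hV hS).aestronglyMeasurable.aemeasurable.ennreal_ofReal
    simpa [measureReal_def] using this

/-- If the sections of `S` are controlled by those of `T₁` and `T₂` off an event `B`, then so are
the probabilities. -/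
theorem measureReal_pair_le (hU : Measurable U) (hV : Measurable V)
    (hUV : IndepFun U V μ) {S T₁ T₂ : Set (α × β)} (hS : MeasurableSet S) (hT₁ : MeasurableSet T₁)
    (hT₂ : MeasurableSet T₂) {B : Set Ω} (hB : MeasurableSet B) {c : ℝ} (hc : 0 ≤ c)
    (h : ∀ᵐ ω ∂μ, ω ∉ B → μ.real {ω' | (U ω, V ω') ∈ S} ≤
      c * (μ.real {ω' | (U ω, V ω') ∈ T₁} + μ.real {ω' | (U ω, V ω') ∈ T₂})) :
    μ.real {ω | (U ω, V ω) ∈ S} ≤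
      c * (μ.real {ω | (U ω, V ω) ∈ T₁} + μ.real {ω | (U ω, V ω) ∈ T₂}) + μ.real B := by
  have i1 := integrable_section (μ := μ) hU hV hT₁
  have i2 := integrable_section (μ := μ) hU hV hT₂
  have iB : Integrable (B.indicator (1 : Ω → ℝ)) μ :=
    (integrable_const (1 : ℝ)).indicator hB
  rw [measureReal_pair_eq_integral hU hV hUV hS, measureReal_pair_eq_integral hU hV hUV hT₁,
    measureReal_pair_eq_integral hU hV hUV hT₂, ← integral_add i1 i2, ← integral_const_mul,
    ← integral_indicator_one hB]
  refine le_trans ?_ (integral_add ((i1.add i2).const_mul c) iB).le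
  refine integral_mono_ae (integrable_section hU hV hS) (((i1.add i2).const_mul c).add iB) ?_
  filter_upwards [h] with ω hω
  change _ ≤ c * (μ.real {ω' | (U ω, V ω') ∈ T₁} + μ.real {ω' | (U ω, V ω') ∈ T₂}) +
    B.indicator 1 ω
  by_cases hb : ω ∈ B
  · have : μ.real {ω' | (U ω, V ω') ∈ S} ≤ 1 := measureReal_le_one
    simp only [hb, indicator_of_mem, Pi.one_apply]
    have : 0 ≤ c * (μ.real {ω' | (U ω, V ω') ∈ T₁} + μ.real {ω' | (U ω, V ω') ∈ T₂}) := by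
      positivity
    linarith
  · simp only [hb, not_false_eq_true, indicator_of_notMem, add_zero]
    exact hω hb

end Conditioning

/-! ### Tails of weighted variables. -/

section Weighted

variable {W X Y : Ω → ℝ} {p : ℝ}

theorem setOf_lt_mul {Ω : Type*} {w : ℝ} (hw : 0 < w) (X : Ω → ℝ) (x : ℝ) :
    {ω | x < w * X ω} = {ω | x / w < X ω} := by
  ext ω
  simp only [mem_ofPred_eq, div_lt_iff₀' hw]

/-- Markov's inequality for the `p`-th moment. -/
theorem measureReal_lt_le_moment (hW0 : ∀ᵐ ω ∂μ, 0 ≤ W ω) (hp : 0 < p)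
    (hWp : Integrable (fun ω => W ω ^ p) μ) {y : ℝ} (hy : 0 < y) :
    μ.real {ω | y < W ω} ≤ (∫ ω, W ω ^ p ∂μ) * y ^ (-p) := by
  have h1 := mul_meas_ge_le_integral_of_nonneg
    (by filter_upwards [hW0] with ω hω using Real.rpow_nonneg hω p) hWp (y ^ p)
  have h2 : μ.real {ω | y < W ω} ≤ μ.real {ω | y ^ p ≤ W ω ^ p} :=
    measureReal_mono fun ω hω => Real.rpow_le_rpow hy.le (le_of_lt hω) hp.le
  rw [Real.rpow_neg hy.le, ← div_eq_mul_inv, le_div_iff₀ (by positivity)]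
  nlinarith [Real.rpow_pos_of_pos hy p]

theorem eventually_weight_tail_le (hW0 : ∀ᵐ ω ∂μ, 0 ≤ W ω) (hp : 0 < p)
    (hWp : Integrable (fun ω => W ω ^ p) μ) {H : ℝ → ℝ} (hH : TailControl p H) {k ε : ℝ}
    (hk : 0 < k) (hε : 0 < ε) :
    ∀ᶠ x in atTop, μ.real {ω | k * x < W ω} ≤ ε * H x := by
  set m := ∫ ω, W ω ^ p ∂μ
  have hm : 0 ≤ m := integral_nonneg_of_ae
    (by filter_upwards [hW0] with ω hω using Real.rpow_nonneg hω p)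
  have hkp : 0 < k ^ (-p) := by positivity
  -- `m + 1` instead of `m` keeps the denominator visibly positive.
  filter_upwards [hH.rpow_neg_le (ε / ((m + 1) * k ^ (-p))) (by positivity),
    eventually_gt_atTop (0 : ℝ)] with x hx hx0
  calc μ.real {ω | k * x < W ω} ≤ m * (k * x) ^ (-p) :=
        measureReal_lt_le_moment hW0 hp hWp (by positivity)
    _ ≤ ((m + 1) * k ^ (-p)) * x ^ (-p) := by
        rw [Real.mul_rpow hk.le hx0.le, ← mul_assoc]
        gcongr
        linarith
    _ ≤ ((m + 1) * k ^ (-p)) * (ε / ((m + 1) * k ^ (-p)) * H x) := by gcongr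
    _ = ε * H x := by field_simp

/-- Given `W`, the level is `x / (W / k)`; the uniform bound of `TailControl` integrates to a finite
constant by the moment hypothesis. -/
theorem exists_weighted_tail_le (hW : Measurable W) (hX : Measurable X)
    (hWX : IndepFun W X μ) (hW0 : ∀ᵐ ω ∂μ, 0 ≤ W ω) (hp : 0 < p)
    (hWp : Integrable (fun ω => W ω ^ p) μ) (hH : TailControl p fun x => μ.real {ω | x < X ω})
    {k : ℝ} (hk : 0 < k) :
    ∃ C : ℝ, 0 < C ∧ ∀ᶠ x in atTop,
      μ.real {ω | k * x < W ω * X ω} ≤ C * μ.real {ω | x < X ω} := by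
  obtain ⟨K, hK, hbound⟩ := hH.div_le
  set m := ∫ ω, W ω ^ p ∂μ
  have hm : 0 ≤ m := integral_nonneg_of_ae
    (by filter_upwards [hW0] with ω hω using Real.rpow_nonneg hω p)
  have hkp : 0 < k ^ (-p) := by positivity
  refine ⟨K * (1 + k ^ (-p) * m), by positivity, ?_⟩
  filter_upwards [hbound, eventually_gt_atTop (0 : ℝ)] with x hx hx0
  have hS : MeasurableSet {v : ℝ × ℝ | k * x < v.1 * v.2} :=
    measurableSet_lt measurable_const (measurable_fst.mul measurable_snd)
  have e := measureReal_pair_eq_integral hW hX hWX hS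
  simp only [mem_ofPred_eq] at e
  have iR : Integrable (fun ω => K * (1 + k ^ (-p) * W ω ^ p) * μ.real {ω | x < X ω}) μ :=
    (((integrable_const _).add (hWp.const_mul _)).const_mul _).mul_const _
  have eR : ∫ ω, K * (1 + k ^ (-p) * W ω ^ p) * μ.real {ω | x < X ω} ∂μ =
      K * (1 + k ^ (-p) * m) * μ.real {ω | x < X ω} := by
    rw [integral_mul_const, integral_const_mul, integral_add (integrable_const _)
      (hWp.const_mul _), integral_const_mul]
    simp [m]
  rw [e, ← eR]
  refine integral_mono_ae (integrable_section hW hX hS) iR ?_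
  filter_upwards [hW0] with ω hω
  rcases hω.eq_or_lt with h | h
  · rw [← h, Real.zero_rpow hp.ne']
    have : {ω' | k * x < 0 * X ω'} = ∅ := by
      ext ω'
      simp only [zero_mul, mem_ofPred_eq, mem_empty_iff_false, iff_false, not_lt]
      positivity
    rw [this, measureReal_empty]
    positivity
  · rw [setOf_lt_mul h]
    have := hx (W ω / k) (by positivity)
    rw [Real.div_rpow h.le hk.le, div_eq_mul_inv (W ω ^ p), ← Real.rpow_neg hk.le,
      mul_comm (W ω ^ p)] at this
    rw [show k * x / W ω = x / (W ω / k) by field_simp]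
    exact this

/-- Some `c > 0` has `P(W > c) > 0`, and `{W > c, X > x / c}` lies in `{W * X > x}`. By
`TailControl`, replacing the level `x / c` by `x` costs a constant factor. -/
theorem exists_tail_le_weighted (hWX : IndepFun W X μ) (hW0 : ∀ᵐ ω ∂μ, 0 ≤ W ω) (hWne : ¬ ∀ᵐ ω ∂μ, W ω = 0)
    (hH : TailControl p fun x => μ.real {ω | x < X ω}) :
    ∃ C : ℝ, 0 < C ∧ ∀ᶠ x in atTop,
      μ.real {ω | x < X ω} ≤ C * μ.real {ω | x < W ω * X ω} := by
  obtain ⟨K, hK, hbound⟩ := hH.div_le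
  obtain ⟨c, hc, hWc⟩ : ∃ c : ℝ, 0 < c ∧ 0 < μ.real {ω | c < W ω} := by
    by_contra! hcon
    refine hWne ?_
    have h0 : ∀ᵐ ω ∂μ, ∀ n : ℕ, W ω ≤ 1 / ((n : ℝ) + 1) := by
      refine ae_all_iff.2 fun n => ?_
      have := le_antisymm (hcon (1 / ((n : ℝ) + 1)) (by positivity)) measureReal_nonneg
      rw [measureReal_eq_zero_iff] at this
      rw [ae_iff]
      simpa only [not_le] using this
    filter_upwards [h0, hW0] with ω h1 h2
    exact le_antisymm (ge_of_tendsto' tendsto_one_div_add_atTop_nhds_zero_nat h1) h2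
  set P := μ.real {ω | c < W ω}
  refine ⟨K * (1 + c⁻¹ ^ p) / P, by positivity, ?_⟩
  have hc' : Tendsto (fun x : ℝ => x / c) atTop atTop := tendsto_id.atTop_div_const hc
  filter_upwards [hc'.eventually hbound, eventually_gt_atTop (0 : ℝ)] with x hx hx0
  have h1 := hx c⁻¹ (by positivity)
  rw [show x / c / c⁻¹ = x by field_simp] at h1
  have h2 : P * μ.real {ω | x / c < X ω} ≤ μ.real {ω | x < W ω * X ω} := by
    have := hWX.measure_inter_preimage_eq_mul (Ioi c) (Ioi (x / c)) measurableSet_Ioi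
      measurableSet_Ioi
    have e : μ.real ({ω | c < W ω} ∩ {ω | x / c < X ω}) = P * μ.real {ω | x / c < X ω} := by
      simp only [P, measureReal_def]
      rw [← ENNReal.toReal_mul]
      exact congrArg ENNReal.toReal this
    rw [← e]
    refine measureReal_mono ?_
    rintro ω ⟨ha, hb⟩
    have ha : c < W ω := ha
    have hb : x / c < X ω := hb
    have hb' := (div_lt_iff₀' hc).1 hb
    have : 0 < X ω := (div_pos hx0 hc).trans hb
    exact hb'.trans (by gcongr)
  calc μ.real {ω | x < X ω} ≤ K * (1 + c⁻¹ ^ p) * μ.real {ω | x / c < X ω} := h1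
    _ = K * (1 + c⁻¹ ^ p) / P * (P * μ.real {ω | x / c < X ω}) := by field_simp
    _ ≤ _ := by gcongr

/-- Joint exceedances are negligible when both variables carry the same weight. -/
theorem eventually_joint_le_same_weight (hW : Measurable W) (hX : Measurable X) (hY : Measurable Y)
    (hWXY : IndepFun W (fun ω => (X ω, Y ω)) μ) (hW0 : ∀ᵐ ω ∂μ, 0 ≤ W ω) (hp : 0 < p)
    (hWp : Integrable (fun ω => W ω ^ p) μ) (hHX : TailControl p fun x => μ.real {ω | x < X ω})
    (hHY : TailControl p fun x => μ.real {ω | x < Y ω})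
    (hQ : ∀ ε : ℝ, 0 < ε → ∀ᶠ x in atTop, μ.real {ω | x < X ω ∧ x < Y ω} ≤
      ε * (μ.real {ω | x < X ω} + μ.real {ω | x < Y ω}))
    {k ε : ℝ} (hk : 0 < k) (hε : 0 < ε) :
    ∀ᶠ x in atTop, μ.real {ω | k * x < W ω * X ω ∧ k * x < W ω * Y ω} ≤
      ε * (μ.real {ω | x < X ω} + μ.real {ω | x < Y ω}) := by
  have hWX : IndepFun W X μ := hWXY.comp measurable_id measurable_fst
  have hWY : IndepFun W Y μ := hWXY.comp measurable_id measurable_snd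
  obtain ⟨C₁, hC₁, hb₁⟩ := exists_weighted_tail_le hW hX hWX hW0 hp hWp hHX hk
  obtain ⟨C₂, hC₂, hb₂⟩ := exists_weighted_tail_le hW hY hWY hW0 hp hWp hHY hk
  -- Half of `ε` goes to moderate weights, where `C₁` and `C₂` remove the weights from the tails,
  -- and half to large weights.
  set δ := ε / (2 * (C₁ + C₂)) with hδ
  have hδ0 : 0 < δ := by positivity
  obtain ⟨x₂, hx₂⟩ := eventually_atTop.1 ((hQ δ hδ0).and (eventually_gt_atTop (0 : ℝ)))
  have hx₂0 : 0 < x₂ := (hx₂ x₂ le_rfl).2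
  filter_upwards [hb₁, hb₂, eventually_gt_atTop (0 : ℝ),
    eventually_weight_tail_le hW0 hp hWp hHX (k := k / x₂) (by positivity) (half_pos hε)]
    with x h1 h2 hx0 h3
  have mX : MeasurableSet {v : ℝ × ℝ × ℝ | k * x < v.1 * v.2.1} :=
    measurableSet_lt measurable_const (by fun_prop)
  have mY : MeasurableSet {v : ℝ × ℝ × ℝ | k * x < v.1 * v.2.2} :=
    measurableSet_lt measurable_const (by fun_prop)
  have key := measureReal_pair_le hW (hX.prodMk hY) hWXY (mX.inter mY) mX mY
    (B := {ω | k / x₂ * x < W ω}) (measurableSet_lt measurable_const hW) hδ0.le ?_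
  · have key' : μ.real {ω | k * x < W ω * X ω ∧ k * x < W ω * Y ω} ≤
        δ * (μ.real {ω | k * x < W ω * X ω} + μ.real {ω | k * x < W ω * Y ω}) +
          μ.real {ω | k / x₂ * x < W ω} := key
    have hx' : 0 ≤ μ.real {ω | x < X ω} := measureReal_nonneg
    have hy' : 0 ≤ μ.real {ω | x < Y ω} := measureReal_nonneg
    have h4 : δ * (μ.real {ω | k * x < W ω * X ω} + μ.real {ω | k * x < W ω * Y ω}) ≤
        δ * ((C₁ + C₂) * (μ.real {ω | x < X ω} + μ.real {ω | x < Y ω})) := by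
      refine mul_le_mul_of_nonneg_left ?_ hδ0.le
      nlinarith [mul_nonneg hC₁.le hy', mul_nonneg hC₂.le hx']
    have h5 : δ * ((C₁ + C₂) * (μ.real {ω | x < X ω} + μ.real {ω | x < Y ω})) =
        ε / 2 * (μ.real {ω | x < X ω} + μ.real {ω | x < Y ω}) := by
      rw [hδ]; field_simp
    nlinarith
  · filter_upwards [hW0] with ω hω hωB
    change μ.real {ω' | k * x < W ω * X ω' ∧ k * x < W ω * Y ω'} ≤
        δ * (μ.real {ω' | k * x < W ω * X ω'} + μ.real {ω' | k * x < W ω * Y ω'})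
    have hωB : ¬ k / x₂ * x < W ω := hωB
    rcases hω.eq_or_lt with h | h
    · have : {ω' | k * x < W ω * X ω' ∧ k * x < W ω * Y ω'} = ∅ := by
        ext ω'
        simp only [← h, zero_mul, mem_ofPred_eq, mem_empty_iff_false, iff_false, and_self]
        have : 0 < k * x := by positivity
        intro h; linarith
      rw [this, measureReal_empty]
      positivity
    -- Off the event of large weights the conditional level is at least `x₂`, where `hQ` is in
    -- force.
    · have h6 : x₂ ≤ k * x / W ω := by
        rw [le_div_iff₀ h]
        rw [not_lt, div_mul_eq_mul_div, le_div_iff₀ hx₂0] at hωB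
        linarith
      have := (hx₂ _ h6).1
      rw [setOf_lt_mul h, setOf_lt_mul h]
      simpa only [div_lt_iff₀' h] using this

/-- Given `W ≤ x / x₁`, the hypothesis on `X` applies at level `x / W ≥ x₁`; the remaining weights
account for the `ε` term. -/
theorem eventually_weighted_dilation_le (hW : Measurable W) (hX : Measurable X)
    (hWX : IndepFun W X μ) (hW0 : ∀ᵐ ω ∂μ, 0 ≤ W ω) (hp : 0 < p)
    (hWp : Integrable (fun ω => W ω ^ p) μ) (hH : TailControl p fun x => μ.real {ω | x < X ω})
    {b c ε : ℝ} (hb : 0 < b) (hc : 0 ≤ c) (hε : 0 < ε)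
    (hbc : ∀ᶠ x in atTop, μ.real {ω | b * x < X ω} ≤ c * μ.real {ω | x < X ω}) :
    ∀ᶠ x in atTop, μ.real {ω | b * x < W ω * X ω} ≤
      c * μ.real {ω | x < W ω * X ω} + ε * μ.real {ω | x < X ω} := by
  obtain ⟨x₁, hx₁⟩ := eventually_atTop.1 (hbc.and (eventually_gt_atTop (0 : ℝ)))
  have hx₁0 : 0 < x₁ := (hx₁ x₁ le_rfl).2
  filter_upwards [eventually_gt_atTop (0 : ℝ),
    eventually_weight_tail_le hW0 hp hWp hH (k := 1 / x₁) (by positivity) hε] with x hx0 h3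
  have mS : ∀ y : ℝ, MeasurableSet {v : ℝ × ℝ | y < v.1 * v.2} := fun y =>
    measurableSet_lt measurable_const (by fun_prop)
  have key := measureReal_pair_le hW hX hWX (mS (b * x)) (mS x) MeasurableSet.empty
    (B := {ω | 1 / x₁ * x < W ω}) (measurableSet_lt measurable_const hW) hc ?_
  · simp only [mem_ofPred_eq, mem_empty_iff_false, ofPred_false, measureReal_empty, add_zero] at key
    linarith
  · filter_upwards [hW0] with ω hω hωB
    simp only [mem_empty_iff_false, ofPred_false, measureReal_empty, add_zero]
    have hωB : ¬ 1 / x₁ * x < W ω := hωB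
    rcases hω.eq_or_lt with h | h
    · have : {ω' | b * x < W ω * X ω'} = ∅ := by
        ext ω'
        simp only [← h, zero_mul, mem_ofPred_eq, mem_empty_iff_false, iff_false, not_lt]
        positivity
      rw [this, measureReal_empty]
      positivity
    · have h6 : x₁ ≤ x / W ω := by
        rw [le_div_iff₀ h]
        rw [not_lt, div_mul_eq_mul_div, one_mul, le_div_iff₀ hx₁0] at hωB
        linarith
      have := (hx₁ _ h6).1
      rw [setOf_lt_mul h, setOf_lt_mul h, mul_div_assoc]
      exact this

end Weighted

/-! ### Sums, unions and joint exceedances. -/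

/-- A Bonferroni inequality. -/
theorem sum_measureReal_le_iUnion_add {ι : Type*} [Fintype ι] [DecidableEq ι] {E : ι → Set Ω}
    (hE : ∀ i, MeasurableSet (E i)) :
    ∑ i, μ.real (E i) ≤ μ.real (⋃ i, E i) +
      ∑ q ∈ (Finset.univ : Finset ι).offDiag, μ.real (E q.1 ∩ E q.2) := by
  -- `E' i` is the part of `E i` met by no other event. Each unordered pair is then subtracted
  -- twice, which is harmless here.
  set E' : ι → Set Ω := fun i => E i \ ⋃ j ∈ Finset.univ.erase i, E j with hE'
  have hm : ∀ i, MeasurableSet (E' i) := fun i =>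
    (hE i).diff (Finset.measurableSet_biUnion _ fun j _ => hE j)
  have hd : Pairwise (Function.onFun Disjoint E') := by
    intro i j hij
    refine Set.disjoint_left.2 fun ω h1 h2 => h1.2 ?_
    simp only [mem_iUnion]
    exact ⟨j, by simp [hij.symm], h2.1⟩
  have h1 : ∑ i, μ.real (E' i) ≤ μ.real (⋃ i, E i) := by
    rw [← measureReal_iUnion_fintype hd hm]
    exact measureReal_mono (iUnion_mono fun i => sdiff_subset)
  have h2 : ∀ i, μ.real (E i) ≤ μ.real (E' i) +
      ∑ j ∈ Finset.univ.erase i, μ.real (E i ∩ E j) := by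
    intro i
    have hsub : E i ⊆ E' i ∪ ⋃ j ∈ Finset.univ.erase i, E i ∩ E j := by
      intro ω hω
      by_cases h : ω ∈ ⋃ j ∈ Finset.univ.erase i, E j
      · right
        simp only [mem_iUnion] at h ⊢
        obtain ⟨j, hj, hωj⟩ := h
        exact ⟨j, hj, hω, hωj⟩
      · exact Or.inl ⟨hω, h⟩
    calc μ.real (E i) ≤ _ := measureReal_mono hsub
      _ ≤ _ := measureReal_union_le _ _
      _ ≤ _ := by gcongr; exact measureReal_biUnion_finset_le _ _
  have h3 : ∑ q ∈ (Finset.univ : Finset ι).offDiag, μ.real (E q.1 ∩ E q.2) =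
      ∑ i, ∑ j ∈ Finset.univ.erase i, μ.real (E i ∩ E j) := by
    rw [Finset.sum_sigma']
    refine Finset.sum_bij' (fun q _ => ⟨q.1, q.2⟩) (fun q _ => (q.1, q.2)) ?_ ?_ ?_ ?_ ?_
    · intro q hq
      simp only [Finset.mem_offDiag] at hq
      simp [hq.2.2.symm]
    · intro q hq
      simp only [Finset.mem_sigma, Finset.mem_erase] at hq
      simp [hq.2.1.symm]
    · intros; rfl
    · intros; rfl
    · intros; rfl
  rw [h3]
  calc ∑ i, μ.real (E i) ≤ ∑ i, (μ.real (E' i) + ∑ j ∈ Finset.univ.erase i, μ.real (E i ∩ E j)) :=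
        Finset.sum_le_sum fun i _ => h2 i
    _ ≤ _ := by rw [Finset.sum_add_distrib]; gcongr

/-- A large sum has one large term or two moderately large terms. -/
theorem exists_large_of_lt_sum {n : ℕ} {c : Fin n → ℝ} {x b : ℝ} (hx : 0 < x) (hb0 : 0 < b)
    (hb1 : b < 1) (h : x < ∑ i, c i) :
    (∃ i, b * x < c i) ∨
      ∃ i j, i ≠ j ∧ (1 - b) / n * x < c i ∧ (1 - b) / n * x < c j := by
  by_contra! hcon
  obtain ⟨h1, h2⟩ := hcon
  rcases Nat.eq_zero_or_pos n with rfl | hn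
  · simp at h; linarith
  have hn' : (0 : ℝ) < n := by exact_mod_cast hn
  have hnk : (n : ℝ) * ((1 - b) / n * x) = (1 - b) * x := by field_simp
  have hb1' : 0 < 1 - b := by linarith
  have hk : 0 < (1 - b) / n * x := by positivity
  -- If one term passes the threshold, the others do not and add up to at most `(1 - b) * x`,
  -- leaving more than `b * x` for it.
  by_cases hi : ∃ i, (1 - b) / n * x < c i
  · obtain ⟨i, hi⟩ := hi
    have h3 : ∑ j ∈ Finset.univ.erase i, c j ≤ ∑ _j : Fin n, (1 - b) / n * x :=
      (Finset.sum_le_sum fun j hj => h2 i j (Finset.ne_of_mem_erase hj).symm hi).trans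
        (Finset.sum_le_sum_of_subset_of_nonneg (Finset.erase_subset _ _) fun _ _ _ => hk.le)
    rw [← Finset.add_sum_erase _ _ (Finset.mem_univ i)] at h
    rw [Finset.sum_const, Finset.card_univ, Fintype.card_fin, nsmul_eq_mul, hnk] at h3
    linarith [h1 i]
  · push Not at hi
    have h3 : ∑ j, c j ≤ ∑ _j : Fin n, (1 - b) / n * x := Finset.sum_le_sum fun j _ => hi j
    rw [Finset.sum_const, Finset.card_univ, Fintype.card_fin, nsmul_eq_mul, hnk] at h3
    nlinarith

/-- Joint exceedances of two weighted variables are negligible. -/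
theorem eventually_joint_le {W₁ W₂ X Y : Ω → ℝ} {p : ℝ} (hW₁ : Measurable W₁)
    (hW₂ : Measurable W₂) (hX : Measurable X) (hY : Measurable Y)
    (h₁ : IndepFun W₁ (fun ω => (X ω, Y ω)) μ) (h₂ : IndepFun W₂ (fun ω => (X ω, Y ω)) μ)
    (hW₁0 : ∀ᵐ ω ∂μ, 0 ≤ W₁ ω) (hW₂0 : ∀ᵐ ω ∂μ, 0 ≤ W₂ ω) (hp : 0 < p)
    (hW₁p : Integrable (fun ω => W₁ ω ^ p) μ) (hW₂p : Integrable (fun ω => W₂ ω ^ p) μ)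
    (hHX : TailControl p fun x => μ.real {ω | x < X ω})
    (hHY : TailControl p fun x => μ.real {ω | x < Y ω})
    (hQ : ∀ ε : ℝ, 0 < ε → ∀ᶠ x in atTop, μ.real {ω | x < X ω ∧ x < Y ω} ≤
      ε * (μ.real {ω | x < X ω} + μ.real {ω | x < Y ω}))
    {k ε : ℝ} (hk : 0 < k) (hε : 0 < ε) :
    ∀ᶠ x in atTop, μ.real {ω | k * x < W₁ ω * X ω ∧ k * x < W₂ ω * Y ω} ≤
      ε * (μ.real {ω | x < X ω} + μ.real {ω | x < Y ω}) := by
  filter_upwards [eventually_gt_atTop (0 : ℝ),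
    eventually_joint_le_same_weight hW₁ hX hY h₁ hW₁0 hp hW₁p hHX hHY hQ hk (half_pos hε),
    eventually_joint_le_same_weight hW₂ hX hY h₂ hW₂0 hp hW₂p hHX hHY hQ hk (half_pos hε)]
    with x hx0 h1 h2
  have hkx : 0 < k * x := by positivity
  have hsub : {ω | k * x < W₁ ω * X ω ∧ k * x < W₂ ω * Y ω} ≤ᵐ[μ]
      ({ω | k * x < W₁ ω * X ω ∧ k * x < W₁ ω * Y ω} ∪
        {ω | k * x < W₂ ω * X ω ∧ k * x < W₂ ω * Y ω} : Set Ω) := by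
    filter_upwards [hW₁0, hW₂0] with ω hw₁ hw₂ hω
    obtain ⟨ha, hb⟩ : k * x < W₁ ω * X ω ∧ k * x < W₂ ω * Y ω := hω
    have hX0 : 0 < X ω := pos_of_mul_pos_right (hkx.trans ha) hw₁
    have hY0 : 0 < Y ω := pos_of_mul_pos_right (hkx.trans hb) hw₂
    -- Since `X` and `Y` are positive here, raising the smaller weight to the larger one preserves
    -- both exceedances.
    rcases le_total (W₂ ω) (W₁ ω) with h | h
    · exact Or.inl ⟨ha, hb.trans_le (mul_le_mul_of_nonneg_right h hY0.le)⟩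
    · exact Or.inr ⟨ha.trans_le (mul_le_mul_of_nonneg_right h hX0.le), hb⟩
  have h3 := ENNReal.toReal_mono (measure_ne_top _ _) (measure_mono_ae hsub)
  have h4 := measureReal_union_le (μ := μ) {ω | k * x < W₁ ω * X ω ∧ k * x < W₁ ω * Y ω}
        {ω | k * x < W₂ ω * X ω ∧ k * x < W₂ ω * Y ω}
  simp only [measureReal_def] at *
  linarith

/-- The tail of a randomly weighted sum lies between its single-jump asymptotics: an upper bound for
the sum and a lower bound for the union of the single exceedances. -/
theorem eventually_weighted_sum_bounds {n : ℕ} {X W : Fin n → Ω → ℝ} {p : ℝ}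
    (hX : ∀ i, Measurable (X i)) (hW : ∀ i, Measurable (W i)) (hW0 : ∀ i, ∀ᵐ ω ∂μ, 0 ≤ W i ω)
    (hWne : ∀ i, ¬ ∀ᵐ ω ∂μ, W i ω = 0) (hWX : IndepFun (fun ω i => W i ω) (fun ω i => X i ω) μ)
    (hp : 0 < p) (hWp : ∀ i, Integrable (fun ω => W i ω ^ p) μ)
    (hH : ∀ i, TailControl p fun x => μ.real {ω | x < X i ω})
    (hC : ∀ i, ∀ ε : ℝ, 0 < ε → ∀ᶠ b in 𝓝[<] (1 : ℝ), ∀ᶠ x in atTop,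
      μ.real {ω | b * x < X i ω} ≤ (1 + ε) * μ.real {ω | x < X i ω})
    (hQ : ∀ i j, i ≠ j → ∀ ε : ℝ, 0 < ε → ∀ᶠ x in atTop, μ.real {ω | x < X i ω ∧ x < X j ω} ≤
      ε * (μ.real {ω | x < X i ω} + μ.real {ω | x < X j ω}))
    {ε : ℝ} (hε : 0 < ε) :
    ∀ᶠ x in atTop,
      μ.real {ω | x < ∑ i, W i ω * X i ω} ≤ (1 + ε) * ∑ i, μ.real {ω | x < W i ω * X i ω} ∧
      (1 - ε) * ∑ i, μ.real {ω | x < W i ω * X i ω} ≤ μ.real (⋃ i, {ω | x < W i ω * X i ω}) := by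
  classical
  have hind : ∀ i j, IndepFun (W i) (fun ω => (X i ω, X j ω)) μ := fun i j =>
    hWX.comp (measurable_pi_apply i) ((measurable_pi_apply i).prodMk (measurable_pi_apply j))
  have hind' : ∀ i j, IndepFun (W j) (fun ω => (X i ω, X j ω)) μ := fun i j =>
    hWX.comp (measurable_pi_apply j) ((measurable_pi_apply i).prodMk (measurable_pi_apply j))
  have hind1 : ∀ i, IndepFun (W i) (X i) μ := fun i =>
    hWX.comp (measurable_pi_apply i) (measurable_pi_apply i)
  choose C hC0 hCb using fun i =>
    exists_tail_le_weighted (hind1 i) (hW0 i) (hWne i) (hH i)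
  set K := 1 + ∑ i, C i
  have hK : 0 < K := by
    have : 0 ≤ ∑ i, C i := Finset.sum_nonneg fun i _ => (hC0 i).le
    positivity
  have hCK : ∀ i, C i ≤ K := fun i => by
    have := Finset.single_le_sum (fun j _ => (hC0 j).le) (Finset.mem_univ i)
    simp only [K]; linarith
  have hcomp : ∀ᶠ x in atTop, ∀ i,
      μ.real {ω | x < X i ω} ≤ K * μ.real {ω | x < W i ω * X i ω} := by
    filter_upwards [eventually_all.2 hCb] with x hx i
    exact (hx i).trans (mul_le_mul_of_nonneg_right (hCK i) measureReal_nonneg)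
  have hjoint : ∀ k : ℝ, 0 < k → ∀ δ : ℝ, 0 < δ → ∀ᶠ x in atTop,
      ∑ q ∈ (Finset.univ : Finset (Fin n)).offDiag,
        μ.real {ω | k * x < W q.1 ω * X q.1 ω ∧ k * x < W q.2 ω * X q.2 ω} ≤
      δ * ∑ i, μ.real {ω | x < W i ω * X i ω} := by
    intro k hk δ hδ
    set N : ℝ := (Finset.univ : Finset (Fin n)).offDiag.card + 1
    have hN : 0 < N := by positivity
    -- In `δ / (2 * K * N)`, the factor `2 * K` bounds two unweighted tails by the sum of weighted
    -- ones, and `N` exceeds the number of pairs.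
    have h1 : ∀ᶠ x in atTop, ∀ i j, i ≠ j →
        μ.real {ω | k * x < W i ω * X i ω ∧ k * x < W j ω * X j ω} ≤
          δ / (2 * K * N) * (μ.real {ω | x < X i ω} + μ.real {ω | x < X j ω}) := by
      refine eventually_all.2 fun i => eventually_all.2 fun j => ?_
      by_cases hij : i = j
      · simp [hij]
      filter_upwards [eventually_joint_le (hW i) (hW j) (hX i) (hX j) (hind i j) (hind' i j)
        (hW0 i) (hW0 j) hp (hWp i) (hWp j) (hH i) (hH j) (hQ i j hij) hk
        (ε := δ / (2 * K * N)) (by positivity)] with x hx _ using hx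
    filter_upwards [h1, hcomp] with x hx hxc
    set D := ∑ i, μ.real {ω | x < W i ω * X i ω}
    have hD : 0 ≤ D := Finset.sum_nonneg fun i _ => measureReal_nonneg
    have h2 : ∀ i, μ.real {ω | x < X i ω} ≤ K * D := fun i =>
      (hxc i).trans (mul_le_mul_of_nonneg_left
        (Finset.single_le_sum (f := fun i => μ.real {ω | x < W i ω * X i ω})
          (fun j _ => measureReal_nonneg) (Finset.mem_univ i)) hK.le)
    have h3 := Finset.sum_le_card_nsmul (Finset.univ : Finset (Fin n)).offDiag
      (fun q => μ.real {ω | k * x < W q.1 ω * X q.1 ω ∧ k * x < W q.2 ω * X q.2 ω})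
      (δ / (2 * K * N) * (K * D + K * D)) (fun q hq =>
        (hx q.1 q.2 (Finset.mem_offDiag.1 hq).2.2).trans
          (mul_le_mul_of_nonneg_left (add_le_add (h2 _) (h2 _)) (by positivity)))
    refine h3.trans ?_
    rw [nsmul_eq_mul]
    calc _ ≤ N * (δ / (2 * K * N) * (K * D + K * D)) := by
          gcongr; simp only [N]; linarith
      _ = δ * D := by field_simp; ring
  -- Three errors share `ε`: dilation by `b`, large weights, joint exceedances.
  set η := ε / 3
  have hη : 0 < η := by positivity
  obtain ⟨b, hbC, hb0, hb1⟩ : ∃ b : ℝ, (∀ i, ∀ᶠ x in atTop,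
      μ.real {ω | b * x < X i ω} ≤ (1 + η) * μ.real {ω | x < X i ω}) ∧ 0 < b ∧ b < 1 := by
    have h1 : ∀ᶠ b in 𝓝[<] (1 : ℝ), 0 < b :=
      (lt_mem_nhds one_pos).filter_mono nhdsWithin_le_nhds
    obtain ⟨b, ⟨h2, h3⟩, h4⟩ :=
      ((eventually_all.2 fun i => hC i η hη).and h1).and self_mem_nhdsWithin |>.exists
    exact ⟨b, h2, h3, h4⟩
  rcases Nat.eq_zero_or_pos n with rfl | hn
  · filter_upwards [eventually_gt_atTop (0 : ℝ)] with x hx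
    simp [not_lt.2 hx.le]
  have hn' : (0 : ℝ) < n := by exact_mod_cast hn
  have hb1' : 0 < 1 - b := by linarith
  have hdil : ∀ᶠ x in atTop, ∀ i, μ.real {ω | b * x < W i ω * X i ω} ≤
      (1 + η) * μ.real {ω | x < W i ω * X i ω} + η / K * μ.real {ω | x < X i ω} :=
    eventually_all.2 fun i => eventually_weighted_dilation_le (hW i) (hX i) (hind1 i) (hW0 i) hp
      (hWp i) (hH i) hb0 (by positivity) (by positivity) (hbC i)
  filter_upwards [hdil, hcomp, hjoint 1 one_pos ε hε,
    hjoint ((1 - b) / n) (by positivity) η hη, eventually_gt_atTop (0 : ℝ)]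
    with x hx hxc hj1 hjk hx0
  set D := ∑ i, μ.real {ω | x < W i ω * X i ω}
  constructor
  · have hsub : {ω | x < ∑ i, W i ω * X i ω} ⊆
        (⋃ i, {ω | b * x < W i ω * X i ω}) ∪
          ⋃ q ∈ (Finset.univ : Finset (Fin n)).offDiag,
            {ω | (1 - b) / n * x < W q.1 ω * X q.1 ω ∧ (1 - b) / n * x < W q.2 ω * X q.2 ω} := by
      intro ω hω
      rcases exists_large_of_lt_sum hx0 hb0 hb1 hω with ⟨i, hi⟩ | ⟨i, j, hij, h⟩
      · exact Or.inl (mem_iUnion.2 ⟨i, hi⟩)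
      · exact Or.inr (mem_iUnion₂.2 ⟨(i, j), by simp [hij], h⟩)
    have h1 : ∑ i, μ.real {ω | b * x < W i ω * X i ω} ≤ (1 + η) * D + η * D := by
      simp only [D]
      rw [Finset.mul_sum, Finset.mul_sum, ← Finset.sum_add_distrib]
      refine Finset.sum_le_sum fun i _ => (hx i).trans (add_le_add le_rfl ?_)
      calc η / K * μ.real {ω | x < X i ω} ≤ η / K * (K * μ.real {ω | x < W i ω * X i ω}) := by
            gcongr; exact hxc i
        _ = _ := by field_simp
    calc μ.real {ω | x < ∑ i, W i ω * X i ω} ≤ _ := measureReal_mono hsub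
      _ ≤ _ := measureReal_union_le _ _
      _ ≤ ((1 + η) * D + η * D) + η * D :=
        add_le_add ((measureReal_iUnion_fintype_le _).trans h1)
          ((measureReal_biUnion_finset_le _ _).trans hjk)
      _ = (1 + ε) * D := by simp only [η]; ring
  · have h1 := sum_measureReal_le_iUnion_add (μ := μ) (E := fun i => {ω | x < W i ω * X i ω})
      fun i => measurableSet_lt measurable_const ((hW i).mul (hX i))
    simp only [one_mul] at hj1
    have h2 : D ≤ μ.real (⋃ i, {ω | x < W i ω * X i ω}) + ε * D :=
      h1.trans (add_le_add le_rfl hj1)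
    linarith

end BigJump

/-! ### Reduction of the vector statement to the gauges. -/

theorem lemma4p3 {Ω : Type*} [MeasurableSpace Ω] (μ : Measure Ω) [IsProbabilityMeasure μ]
    {d n : ℕ} (hn : 1 ≤ n)
    (A : Set (Fin d → ℝ)) (hA : BigJump.IsRareSet A)
    (Z : Fin n → Ω → Fin d → ℝ) (hZ_meas : ∀ i, Measurable (Z i))
    (hZ_nonneg : ∀ i, ∀ᵐ ω ∂μ, 0 ≤ Z i ω)
    (hZ_QAI : BigJump.QAIOn μ A Z)
    (hZ_C : ∀ i, BigJump.ConsistentlyVaryingOn A (μ.map (Z i)))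
    (W : Fin n → Ω → ℝ) (hW_meas : ∀ i, Measurable (W i))
    (hW_nonneg : ∀ i, ∀ᵐ ω ∂μ, 0 ≤ W i ω)
    (hW_nondeg : ∀ i, ¬ ∀ᵐ ω ∂μ, W i ω = 0)
    (hWZ : IndepFun (fun ω i => W i ω) (fun ω i => Z i ω) μ)
    (p : ℝ)
    (hp : (⨆ i, BigJump.upperMatuszewskaIndex (BigJump.rareLaw A (μ.map (Z i)))) < (p : EReal))
    (hW_moment : ∀ i, Integrable (fun ω => W i ω ^ p) μ) :
    Tendsto (fun x : ℝ =>
        μ.real {ω | ∑ i, W i ω • Z i ω ∈ x • A} / ∑ i, μ.real {ω | W i ω • Z i ω ∈ x • A})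
      atTop (𝓝 1) := by
  have hm := hA.measurable_rareSup
  set X : Fin n → Ω → ℝ := fun i ω => BigJump.rareSup A (Z i ω)
  have hX : ∀ i, Measurable (X i) := fun i => hm.comp (hZ_meas i)
  have hlaw : ∀ i, BigJump.rareLaw A (μ.map (Z i)) = μ.map (X i) := fun i =>
    Measure.map_map hm (hZ_meas i)
  have hprob : ∀ i, IsProbabilityMeasure (μ.map (X i)) := fun i =>
    Measure.isProbabilityMeasure_map (hX i).aemeasurable
  have htail : ∀ i x, (μ.map (X i)).real (Ioi x) = μ.real {ω | x < X i ω} := fun i x =>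
    map_measureReal_apply (hX i) measurableSet_Ioi
  have hC : ∀ i, BigJump.ConsistentlyVarying (μ.map (X i)) := fun i => hlaw i ▸ hZ_C i
  have hpos : ∀ i x, 0 < μ.real {ω | x < X i ω} := fun i x => by
    rw [← htail]
    exact ENNReal.toReal_pos ((hC i).1 x).ne' (measure_ne_top _ _)
  have hctl : ∀ i, 0 < p ∧ BigJump.TailControl p fun x => μ.real {ω | x < X i ω} := fun i => by
    have h1 : BigJump.upperMatuszewskaIndex (μ.map (X i)) < p := by
      rw [← hlaw]
      exact (le_iSup (fun i => BigJump.upperMatuszewskaIndex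
        (BigJump.rareLaw A (μ.map (Z i)))) i).trans_lt hp
    have := BigJump.exists_tailControl (hC i).1 h1
    simpa only [htail] using this
  have hp0 : 0 < p := (hctl ⟨0, hn⟩).1
  have hWX : IndepFun (fun ω i => W i ω) (fun ω i => X i ω) μ :=
    hWZ.comp measurable_id (measurable_pi_lambda _ fun i => hm.comp (measurable_pi_apply i))
  have hQ : ∀ i j, i ≠ j → ∀ ε : ℝ, 0 < ε → ∀ᶠ x in atTop,
      μ.real {ω | x < X i ω ∧ x < X j ω} ≤
        ε * (μ.real {ω | x < X i ω} + μ.real {ω | x < X j ω}) := by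
    intro i j hij ε hε
    filter_upwards [(hZ_QAI i j hij).eventually (gt_mem_nhds hε)] with x hx
    exact ((div_lt_iff₀ (add_pos (hpos i x) (hpos j x))).1 hx).le
  have hbounds := fun ε hε => BigJump.eventually_weighted_sum_bounds (ε := ε) hX hW_meas hW_nonneg
    hW_nondeg hWX hp0 hW_moment (fun i => (hctl i).2)
    (fun i ε hε => by simpa only [htail] using (hC i).exists_tail_le hε) hQ hε
  -- This comparison is needed only to see that the denominator is positive.
  obtain ⟨K, -, hK⟩ := BigJump.exists_tail_le_weighted (W := W ⟨0, hn⟩)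
    (X := X ⟨0, hn⟩) (hWX.comp (measurable_pi_apply _) (measurable_pi_apply _)) (hW_nonneg ⟨0, hn⟩)
    (hW_nondeg ⟨0, hn⟩) (hctl ⟨0, hn⟩).2
  have hall0 : ∀ᵐ ω ∂μ, ∀ i, 0 ≤ W i ω ∧ 0 ≤ Z i ω :=
    ae_all_iff.2 fun i => (hW_nonneg i).and (hZ_nonneg i)
  rw [Metric.tendsto_atTop']
  intro ε hε
  obtain ⟨N, hN⟩ := eventually_atTop.1
    -- `ε / 2` turns the non-strict bounds into a distance strictly below `ε`.
    ((hbounds (ε / 2) (half_pos hε)).and (hK.and (eventually_gt_atTop (0 : ℝ))))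
  refine ⟨N, fun x hxN => ?_⟩
  obtain ⟨⟨hup, hlow⟩, hKx, hx0⟩ := hN x hxN.le
  have hterm : ∀ i, μ.real {ω | W i ω • Z i ω ∈ x • A} = μ.real {ω | x < W i ω * X i ω} := by
    intro i
    refine measureReal_congr ?_
    filter_upwards [hW_nonneg i] with ω hω
    exact propext (hA.smul_mem_smul_iff hx0 hω (Z i ω))
  simp only [hterm]
  set D := ∑ i, μ.real {ω | x < W i ω * X i ω}
  have hD : 0 < D := by
    refine Finset.sum_pos' (fun i _ => measureReal_nonneg) ⟨⟨0, hn⟩, Finset.mem_univ _, ?_⟩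
    refine lt_of_le_of_ne measureReal_nonneg fun h0 => ?_
    rw [← h0, mul_zero] at hKx
    exact absurd (hpos ⟨0, hn⟩ x) (not_lt.2 hKx)
  have h1 : μ.real {ω | ∑ i, W i ω • Z i ω ∈ x • A} ≤ (1 + ε / 2) * D := by
    refine le_trans (ENNReal.toReal_mono (measure_ne_top _ _) (measure_mono_ae ?_)) hup
    filter_upwards [hall0] with ω hω hmem
    exact hA.lt_sum_of_mem Finset.univ hx0 (fun i => (hω i).1) (fun i => (hω i).2) hmem
  have h2 : (1 - ε / 2) * D ≤ μ.real {ω | ∑ i, W i ω • Z i ω ∈ x • A} := by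
    refine hlow.trans (ENNReal.toReal_mono (measure_ne_top _ _) (measure_mono_ae ?_))
    filter_upwards [hall0] with ω hω hmem
    obtain ⟨i, hi⟩ := mem_iUnion.1 hmem
    exact hA.sum_mem_of_mem hx0 (fun j => smul_nonneg (hω j).1 (hω j).2) i
      ((hA.smul_mem_smul_iff hx0 (hω i).1 (Z i ω)).2 hi)
  rw [Real.dist_eq, abs_lt, lt_sub_iff_add_lt, sub_lt_iff_lt_add, lt_div_iff₀ hD, div_lt_iff₀ hD]
  constructor <;> nlinarith
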